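/- A configuration system with parameter $b\in\mathbb N$ consists of a universe $\mathbb U$, a finite family $S$ of $n=|S|$ objects (subsets of $\mathbb U$), a finite family of configurations $c=(y,B_y)$, each given by a region $y\subseteq\mathbb U$ and a set $B_y\subseteq S$ of at most $b$ objects defining it, and a conflict relation between objects and configurations such that $s$ conflicts with $(y,B_y)$ whenever $s\cap y\neq\emptyset$ (further conflicts are allowed). For $H\subseteq S$, a $j$-region of $H$ is a configuration $(y,B_y)$ with $B_y\subseteq H$ that conflicts with exactly $j$ objects of $H$; $\mathcal F_0(H)$ is the set of $0$-regions of $H$. The system is complete if, for every $R\subseteq S$, each point of $\mathbb U\setminus\bigcup R$ lies in the region of some $0$-region of $R$. An $\epsilon$-net for $T\subseteq S$ is a set $N\subseteq T$ such that every point of $\mathbb U$ contained in at least $\epsilon|T|$ objects of $T$ is contained in some object of $N$. For an integer $q\ge 2$ and a constant $K$, a likely $1/q$-net for $T\subseteq S$ is a set $R\subseteq T$ with $|R|\le Kq\log q$ such that every $0$-region of $R$ is a $j$-region of $T$ for some $j\le |T|/q$. **Theorem.** For every $b\in\mathbb N$ and $K\in\mathbb R$ there is a constant $C>0$, depending only on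 $b$ and $K$, such that the following holds. Take any complete configuration system with parameter $b$ such that, for every subset $T\subseteq S$ and every integer $q\ge 2$, a likely $1/q$-net for $T$ with constant $K$ exists. Let $f(r):=E|\mathcal F_0(R)|$, where $R\subseteq S$ is a uniformly random subset of size $r$. Then for every integer $r$ with $1\le r\le |S|$ and $r\ge 2b$, there is a $1/r$-net for $S$ of size at most $C\max(r,f(r))$. In particular, if $f(r)\ge r$, there is a $1/r$-net for $S$ of size at most $C f(r)$. -/

import Mathlib

/-- A configuration system with parameter `b`: a universe `U`, a finite family `S` of objects
(subsets of `U`, indexed by `ι`), and a finite family of configurations, indexed by `κ`.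
A configuration `c` is a pair of a region `region c ⊆ U` and a set `definers c` of at most `b`
objects defining it. An object that meets the region of `c` conflicts with `c`; there may be
further conflicts (for instance from tie-breaking). -/
structure ConfigurationSystem (U ι κ : Type*) (b : ℕ) where
  obj : ι → Set U
  region : κ → Set U
  definers : κ → Finset ι
  card_definers_le : ∀ c, (definers c).card ≤ b
  Conflicts : ι → κ → Prop
  conflicts_of_meets : ∀ s c, (obj s ∩ region c).Nonempty → Conflicts s c

namespace ConfigurationSystem

variable {U ι κ : Type*} {b : ℕ}

/-- The union of the objects in `H`. -/
def cover (D : ConfigurationSystem U ι κ b) (H : Finset ι) : Set U :=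
  ⋃ s ∈ H, D.obj s

open Classical in
/-- The number of objects in `H` that conflict with the configuration `c`. -/
noncomputable def conflictCount (D : ConfigurationSystem U ι κ b) (H : Finset ι) (c : κ) : ℕ :=
  (H.filter fun s => D.Conflicts s c).card

open Classical in
/-- The `j`-regions of `H`: the configurations that are defined by objects of `H` and conflict
with exactly `j` objects of `H`. -/
noncomputable def regions [Fintype κ] (D : ConfigurationSystem U ι κ b) (j : ℕ) (H : Finset ι) :
    Finset κ :=
  Finset.univ.filter fun c => D.definers c ⊆ H ∧ D.conflictCount H c = j

/-- The system is complete if, for every set `R` of objects, each point that is in no object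
of `R` is in some `0`-region of `R`. -/
def IsComplete [Fintype κ] (D : ConfigurationSystem U ι κ b) : Prop :=
  ∀ R : Finset ι, ∀ p : U, p ∉ D.cover R → ∃ c ∈ D.regions 0 R, p ∈ D.region c

open Classical in
/-- The number of objects in `T` that contain the point `p`. -/
noncomputable def depth (D : ConfigurationSystem U ι κ b) (T : Finset ι) (p : U) : ℕ :=
  (T.filter fun s => p ∈ D.obj s).card

/-- `N` is an `ε`-net for the objects `T`: it is a subset of `T` that covers all points
contained in at least `ε |T|` objects of `T`. -/
def IsNet (D : ConfigurationSystem U ι κ b) (ε : ℝ) (T N : Finset ι) : Prop :=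
  N ⊆ T ∧ ∀ p : U, ε * (T.card : ℝ) ≤ (D.depth T p : ℝ) → p ∈ D.cover N

/-- `R` is a likely `1/q`-net for the objects `T`, with constant `K`: it is a subset of `T` of
size at most `K q log q`, and every `0`-region of `R` is a `j`-region of `T` for
some `j ≤ |T| / q`. -/
def IsLikelyNet [Fintype κ] (D : ConfigurationSystem U ι κ b) (K : ℝ) (q : ℕ)
    (T R : Finset ι) : Prop :=
  R ⊆ T ∧ (R.card : ℝ) ≤ K * q * Real.log q ∧
    ∀ c ∈ D.regions 0 R, ∃ j : ℕ, (j : ℝ) ≤ (T.card : ℝ) / q ∧ c ∈ D.regions j T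

/-- Likely `1/q`-nets with constant `K` exist for every subset of the objects and every
integer `q ≥ 2`. -/
def LikelyNetsExist [Fintype κ] (D : ConfigurationSystem U ι κ b) (K : ℝ) : Prop :=
  ∀ (T : Finset ι) (q : ℕ), 2 ≤ q → ∃ R : Finset ι, D.IsLikelyNet K q T R

/-- The expected number of `0`-regions of `R`, where `R` is a uniformly random set of exactly `r`
objects (meaningful for `r ≤ |S|`). -/
noncomputable def expectedZeroRegions [Fintype ι] [Fintype κ] (D : ConfigurationSystem U ι κ b)
    (r : ℕ) : ℝ :=
  (∑ R ∈ (Finset.univ : Finset ι).powersetCard r, ((D.regions 0 R).card : ℝ)) /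
    (((Finset.univ : Finset ι).powersetCard r).card : ℝ)

end ConfigurationSystem

/-! Sample `2r` of the `n` objects and repair the sample `R`. By completeness a point missed by `R`
lies in a `0`-region `c` of `R`. Let `c` have `k` conflicts and put `t = k r / n`. Every object
containing a point of the region conflicts with `c`, so points of depth at least `n / r` occur there
only if `t ≥ 1`, and then a likely net for the `k` conflicting objects covers them at cost `O(t²)`
(`exists_local_net`).

The total repair cost is small on average. Growing the sample from `r` to `2r` multiplies the
probability that `c` is a `0`-region by at most `exp (2b - t)` (`zeroProb_two_mul_le`), which
absorbs `t²`. The expected cost is thus `O(f(r))`, and some sample does no worse than the average.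
-/

namespace ConfigurationSystem

variable {U ι κ : Type*} {b : ℕ}

/-! ### Conflicts, depth and local nets -/

open Classical in
/-- The objects conflicting with a configuration. -/
noncomputable def conflictSet [Fintype ι] (D : ConfigurationSystem U ι κ b) (c : κ) : Finset ι :=
  Finset.univ.filter fun s => D.Conflicts s c

theorem mem_conflictSet [Fintype ι] (D : ConfigurationSystem U ι κ b) (c : κ) (s : ι) :
    s ∈ D.conflictSet c ↔ D.Conflicts s c := by
  simp [conflictSet]

theorem mem_regions_zero_iff [Fintype ι] [Fintype κ] (D : ConfigurationSystem U ι κ b)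
    (H : Finset ι) (c : κ) :
    c ∈ D.regions 0 H ↔ D.definers c ⊆ H ∧ Disjoint H (D.conflictSet c) := by
  classical
  simp [regions, conflictCount, Finset.filter_eq_empty_iff, Finset.disjoint_left,
    mem_conflictSet]

/-- The depth of a point in the region of `c` is at most the number of conflicts of `c`. -/
theorem depth_le_conflictCount (D : ConfigurationSystem U ι κ b) (T : Finset ι) {c : κ} {p : U}
    (hp : p ∈ D.region c) : D.depth T p ≤ D.conflictCount T c := by
  classical
  refine Finset.card_le_card fun s hs => ?_
  rw [Finset.mem_filter] at hs ⊢
  exact ⟨hs.1, D.conflicts_of_meets s c ⟨p, hs.2, hp⟩⟩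

/-- Every object through `p` conflicts with `c`, so global depth can be tested inside the conflict
set. -/
theorem depth_conflictSet [Fintype ι] (D : ConfigurationSystem U ι κ b) {c : κ} {p : U}
    (hp : p ∈ D.region c) : D.depth (D.conflictSet c) p = D.depth Finset.univ p := by
  classical
  unfold depth
  congr 1
  ext s
  simp only [Finset.mem_filter, mem_conflictSet, Finset.mem_univ, true_and, and_iff_right_iff_imp]
  exact fun hs => D.conflicts_of_meets s c ⟨p, hs, hp⟩

theorem mem_cover_of_isLikelyNet [Fintype κ] {D : ConfigurationSystem U ι κ b}
    (hD : D.IsComplete) {K : ℝ} {q : ℕ} {T R : Finset ι} (hR : D.IsLikelyNet K q T R) {p : U}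
    (hp : (T.card : ℝ) / q < D.depth T p) : p ∈ D.cover R := by
  by_contra hcov
  obtain ⟨c, hc, hpc⟩ := hD R p hcov
  obtain ⟨j, hj, hcj⟩ := hR.2.2 c hc
  have hcount : D.conflictCount T c = j := by
    classical
    exact (Finset.mem_filter.1 hcj).2.2
  have hle : (D.depth T p : ℝ) ≤ j := by
    exact_mod_cast hcount ▸ D.depth_le_conflictCount T hpc
  linarith

/-- The deep points in the region of `c` can be covered by few objects, in terms of the relative
number of conflicts of `c`. -/
theorem exists_local_net [Fintype ι] [Fintype κ] {D : ConfigurationSystem U ι κ b}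
    (hD : D.IsComplete) {K : ℝ} (hK : D.LikelyNetsExist K) {r : ℕ} (hr : 1 ≤ r)
    (hn : 0 < Fintype.card ι) (c : κ) :
    ∃ N : Finset ι,
      (N.card : ℝ) ≤ 4 * |K| * (((D.conflictSet c).card : ℝ) * r / Fintype.card ι) ^ 2 ∧
      ∀ p ∈ D.region c, (Fintype.card ι : ℝ) / r ≤ D.depth Finset.univ p → p ∈ D.cover N := by
  set n := Fintype.card ι
  set k := (D.conflictSet c).card with hk
  have hn' : (0 : ℝ) < n := by exact_mod_cast hn
  have hr' : (0 : ℝ) < r := by exact_mod_cast hr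
  rcases lt_or_ge (k * r) n with hlt | hge
  · refine ⟨∅, by simp; positivity, fun p hp hdeep => ?_⟩
    exfalso
    rw [← D.depth_conflictSet hp] at hdeep
    have h1 : D.depth (D.conflictSet c) p ≤ k := by
      classical
      exact Finset.card_filter_le _ _
    have h2 : (D.depth (D.conflictSet c) p : ℝ) ≤ k := by exact_mod_cast h1
    have h3 : (k : ℝ) * r < n := by exact_mod_cast hlt
    rw [div_le_iff₀ hr'] at hdeep
    nlinarith
  · set t : ℝ := (k : ℝ) * r / n with ht
    have ht1 : 1 ≤ t := by
      rw [ht, le_div_iff₀ hn', one_mul]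
      exact_mod_cast hge
    -- The strict `t < q` gives `k / q < n / r`, so a likely `1/q`-net covers the deep points; `q ≤
    -- 2t` keeps it small.
    set q := ⌊t⌋₊ + 1 with hq
    have hq2 : 2 ≤ q := by
      have : 1 ≤ ⌊t⌋₊ := Nat.le_floor (by exact_mod_cast ht1)
      omega
    have htq : t < q := by
      rw [hq]
      exact_mod_cast Nat.lt_floor_add_one t
    have hqt : (q : ℝ) ≤ 2 * t := by
      have := Nat.floor_le (zero_le_one.trans ht1)
      rw [hq]
      push_cast
      linarith
    have hq0 : (0 : ℝ) < q := by linarith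
    obtain ⟨R, hR⟩ := hK (D.conflictSet c) q hq2
    refine ⟨R, hR.2.1.trans ?_, fun p hp hdeep => mem_cover_of_isLikelyNet hD hR ?_⟩
    · have hlog : Real.log q ≤ q := Real.log_le_self hq0.le
      have hlog0 : 0 ≤ Real.log q := Real.log_natCast_nonneg q
      calc K * q * Real.log q = K * (q * Real.log q) := by ring
        _ ≤ |K| * (q * Real.log q) := by gcongr; exact le_abs_self K
        _ ≤ |K| * ((2 * t) * (2 * t)) := by gcongr; exact hlog.trans hqt
        _ = 4 * |K| * t ^ 2 := by ring
    · rw [D.depth_conflictSet hp]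
      refine lt_of_lt_of_le ?_ hdeep
      rw [ht, div_lt_iff₀ hn'] at htq
      rw [← hk, div_lt_div_iff₀ hq0 hr']
      linarith

/-! ### Decay of `0`-region probabilities as the sample grows -/

open Classical in
/-- The number of `m`-element sets of objects that have `c` as a `0`-region. -/
noncomputable def zeroCount [Fintype ι] [Fintype κ] (D : ConfigurationSystem U ι κ b)
    (m : ℕ) (c : κ) : ℕ :=
  (((Finset.univ : Finset ι).powersetCard m).filter fun R => c ∈ D.regions 0 R).card

/-- The probability that `c` is a `0`-region of a random `m`-element set of objects. -/
noncomputable def zeroProb [Fintype ι] [Fintype κ] (D : ConfigurationSystem U ι κ b)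
    (m : ℕ) (c : κ) : ℝ :=
  (D.zeroCount m c : ℝ) / ((Fintype.card ι).choose m : ℝ)

theorem zeroProb_nonneg [Fintype ι] [Fintype κ] (D : ConfigurationSystem U ι κ b)
    (m : ℕ) (c : κ) : 0 ≤ D.zeroProb m c := by
  unfold zeroProb
  positivity

theorem zeroCount_eq_zero_of_not_disjoint [Fintype ι] [Fintype κ]
    (D : ConfigurationSystem U ι κ b) (m : ℕ) {c : κ}
    (h : ¬ Disjoint (D.definers c) (D.conflictSet c)) : D.zeroCount m c = 0 := by
  classical
  rw [zeroCount, Finset.card_eq_zero, Finset.filter_eq_empty_iff]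
  intro R _ hR
  rw [mem_regions_zero_iff] at hR
  exact h (hR.2.mono_left hR.1)

/-- Such a sample consists of the definers plus a free choice among the objects that neither define
`c` nor conflict with it. -/
theorem zeroCount_eq_choose [Fintype ι] [Fintype κ] (D : ConfigurationSystem U ι κ b) {m : ℕ}
    {c : κ} (h : Disjoint (D.definers c) (D.conflictSet c)) (hm : (D.definers c).card ≤ m) :
    D.zeroCount m c = (Fintype.card ι - ((D.definers c).card + (D.conflictSet c).card)).choose
      (m - (D.definers c).card) := by
  classical
  set B := D.definers c
  set T := D.conflictSet c
  have hcard : (Finset.univ \ (B ∪ T)).card = Fintype.card ι - (B.card + T.card) := by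
    rw [Finset.card_sdiff_of_subset (Finset.subset_univ _), Finset.card_union_of_disjoint h,
      Finset.card_univ]
  rw [← hcard, ← Finset.card_powersetCard, zeroCount]
  refine Finset.card_bij' (fun R _ => R \ B) (fun A _ => A ∪ B) ?_ ?_ ?_ ?_
  · intro R hR
    rw [Finset.mem_filter, Finset.mem_powersetCard, mem_regions_zero_iff] at hR
    obtain ⟨⟨-, hRm⟩, hBR, hRT⟩ := hR
    rw [Finset.mem_powersetCard, Finset.card_sdiff_of_subset hBR, hRm]
    refine ⟨fun s hs => ?_, rfl⟩
    rw [Finset.mem_sdiff] at hs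
    simp only [Finset.mem_sdiff, Finset.mem_univ, Finset.mem_union, true_and, not_or]
    exact ⟨hs.2, Finset.disjoint_left.1 hRT hs.1⟩
  · intro A hA
    rw [Finset.mem_powersetCard] at hA
    have hAB : Disjoint A B := Finset.disjoint_left.2 fun s hs hsB =>
      (Finset.mem_sdiff.1 (hA.1 hs)).2 (Finset.mem_union_left _ hsB)
    have hAT : Disjoint A T := Finset.disjoint_left.2 fun s hs hsT =>
      (Finset.mem_sdiff.1 (hA.1 hs)).2 (Finset.mem_union_right _ hsT)
    rw [Finset.mem_filter, Finset.mem_powersetCard, mem_regions_zero_iff,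
      Finset.card_union_of_disjoint hAB, hA.2]
    exact ⟨⟨Finset.subset_univ _, by omega⟩, Finset.subset_union_right,
      Finset.disjoint_union_left.2 ⟨hAT, h⟩⟩
  · intro R hR
    rw [Finset.mem_filter, mem_regions_zero_iff] at hR
    exact Finset.sdiff_union_of_subset hR.2.1
  · intro A hA
    rw [Finset.mem_powersetCard] at hA
    refine Finset.union_sdiff_cancel_right (Finset.disjoint_left.2 fun s hs hsB => ?_)
    exact (Finset.mem_sdiff.1 (hA.1 hs)).2 (Finset.mem_union_left _ hsB)

/-- With `d` definers, the ratio of the probabilities is `(m+1)/(m-d+1)` times `(n-k-m)/(n-m)`;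
these are at most `1 + 2b/r` and `1 - k/n`. -/
theorem zeroProb_succ_le [Fintype ι] [Fintype κ] (D : ConfigurationSystem U ι κ b) {r m : ℕ}
    (hr : 1 ≤ r) (hb : 2 * b ≤ r) (hrm : r ≤ m) (hm : m < Fintype.card ι) (c : κ) :
    D.zeroProb (m + 1) c ≤ D.zeroProb m c *
      Real.exp (2 * b / r - (D.conflictSet c).card / Fintype.card ι) := by
  by_cases hdisj : Disjoint (D.definers c) (D.conflictSet c)
  swap
  · simp [zeroProb, D.zeroCount_eq_zero_of_not_disjoint _ hdisj]
  have hd : (D.definers c).card ≤ b := D.card_definers_le c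
  have hdm : (D.definers c).card ≤ m := by omega
  unfold zeroProb
  rw [D.zeroCount_eq_choose hdisj hdm, D.zeroCount_eq_choose hdisj (hdm.trans m.le_succ)]
  set n := Fintype.card ι
  set d := (D.definers c).card
  set k := (D.conflictSet c).card
  have hdr : (d : ℝ) ≤ b := by exact_mod_cast hd
  have hr' : (1 : ℝ) ≤ r := by exact_mod_cast hr
  have hbr : 2 * (b : ℝ) ≤ r := by exact_mod_cast hb
  have hrm' : (r : ℝ) ≤ m := by exact_mod_cast hrm
  have hmn : (m : ℝ) < n := by exact_mod_cast hm
  have hchoose : (0 : ℝ) < (n.choose m : ℝ) := by exact_mod_cast Nat.choose_pos hm.le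
  rw [show m + 1 - d = (m - d) + 1 by omega]
  have hrec := Nat.choose_succ_right_eq (n - (d + k)) (m - d)
  have hrecn := Nat.choose_succ_right_eq n m
  have hrecn' : (n.choose (m + 1) : ℝ) * (m + 1) = n.choose m * (n - m) := by
    have := congrArg (Nat.cast : ℕ → ℝ) hrecn
    push_cast [Nat.cast_sub hm.le] at this
    exact this
  -- Either too few free objects remain and the larger count vanishes, or no natural subtraction
  -- below truncates.
  rcases lt_or_ge (n - (d + k)) (m - d + 1) with hlt | hge
  · rw [Nat.choose_eq_zero_of_lt hlt, Nat.cast_zero, zero_div]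
    positivity
  · have hsub : n - (d + k) - (m - d) = n - k - m := by omega
    have hkm : k + m ≤ n := by omega
    have hkm' : (k : ℝ) + m ≤ n := by exact_mod_cast hkm
    rw [hsub] at hrec
    set x := (n - (d + k)).choose (m - d + 1)
    set y := (n - (d + k)).choose (m - d)
    have hrec' : (x : ℝ) * (m - d + 1) = y * (n - k - m) := by
      have := congrArg (Nat.cast : ℕ → ℝ) hrec
      push_cast [Nat.cast_sub hdm, Nat.cast_sub (show k ≤ n by omega),
        Nat.cast_sub (show m ≤ n - k by omega)] at this
      exact this
    have hk0 : (0 : ℝ) ≤ k := Nat.cast_nonneg k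
    have hb0 : (0 : ℝ) ≤ b := Nat.cast_nonneg b
    have hnm : (0 : ℝ) < n - m := by linarith
    have hmd : (0 : ℝ) < (m : ℝ) - d + 1 := by linarith
    have hquot : (x : ℝ) / n.choose (m + 1) =
        y / n.choose m * (((m + 1) / (m - d + 1)) * ((n - k - m) / (n - m))) := by
      have hx : (x : ℝ) = y * (n - k - m) / (m - d + 1) := by
        rw [eq_div_iff hmd.ne', hrec']
      have hc : (n.choose (m + 1) : ℝ) = n.choose m * (n - m) / (m + 1) := by
        rw [eq_div_iff (by positivity), hrecn']
      rw [hx, hc]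
      field_simp
    rw [hquot]
    refine mul_le_mul_of_nonneg_left ?_ (by positivity)
    rw [sub_eq_add_neg (2 * (b : ℝ) / r), Real.exp_add]
    refine mul_le_mul ?_ ?_ (div_nonneg (by linarith) hnm.le) (Real.exp_pos _).le
    -- Since `d ≤ b ≤ r/2` and `r ≤ m`, the denominator `m - d + 1` exceeds `r/2`.
    · refine le_trans ?_ (Real.add_one_le_exp _)
      rw [div_le_iff₀ hmd, div_add_one (by positivity), div_mul_eq_mul_div,
        le_div_iff₀ (by positivity)]
      nlinarith [mul_nonneg hb0 (sub_nonneg.2 hrm'), mul_nonneg hb0 (sub_nonneg.2 hdr),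
        mul_nonneg hb0 (sub_nonneg.2 hbr), mul_nonneg (zero_le_one.trans hr') (sub_nonneg.2 hdr)]
    · refine le_trans ?_ (Real.add_one_le_exp _)
      have hn0 : (0 : ℝ) < n := by linarith
      have : ((n : ℝ) - k - m) / (n - m) = -(k / (n - m)) + 1 := by
        field_simp
        ring
      rw [this]
      gcongr
      linarith

theorem zeroProb_add_le [Fintype ι] [Fintype κ] (D : ConfigurationSystem U ι κ b) {r : ℕ}
    (hr : 1 ≤ r) (hb : 2 * b ≤ r) (c : κ) (i : ℕ) (hi : r + i ≤ Fintype.card ι) :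
    D.zeroProb (r + i) c ≤ D.zeroProb r c *
      Real.exp (i * (2 * b / r - (D.conflictSet c).card / Fintype.card ι)) := by
  induction i with
  | zero => simp
  | succ i ih =>
    refine (D.zeroProb_succ_le hr hb (Nat.le_add_right r i) (by omega) c).trans ?_
    refine (mul_le_mul_of_nonneg_right (ih (by omega)) (Real.exp_pos _).le).trans_eq ?_
    rw [mul_assoc, ← Real.exp_add]
    push_cast
    ring_nf

/-- Doubling the sample size makes configurations with many conflicts exponentially less likely
to be `0`-regions of the sample. -/
theorem zeroProb_two_mul_le [Fintype ι] [Fintype κ] (D : ConfigurationSystem U ι κ b) {r : ℕ}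
    (hr : 1 ≤ r) (hb : 2 * b ≤ r) (hn : 2 * r ≤ Fintype.card ι) (c : κ) :
    D.zeroProb (2 * r) c ≤ D.zeroProb r c *
      Real.exp (2 * b - (D.conflictSet c).card * r / Fintype.card ι) := by
  have h := D.zeroProb_add_le hr hb c r (by omega)
  rw [← two_mul] at h
  refine h.trans_eq ?_
  have hr' : (r : ℝ) ≠ 0 := by exact_mod_cast (by omega : r ≠ 0)
  congr 2
  field_simp

/-! ### Averaging over samples -/

/-- Double counting of pairs of a sample and a weighted `0`-region of it. -/
theorem sum_powersetCard_sum_regions [Fintype ι] [Fintype κ] (D : ConfigurationSystem U ι κ b)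
    (m : ℕ) (w : κ → ℝ) :
    ∑ R ∈ (Finset.univ : Finset ι).powersetCard m, ∑ c ∈ D.regions 0 R, w c =
      ∑ c, (D.zeroCount m c : ℝ) * w c := by
  classical
  have h : ∀ R : Finset ι, ∑ c ∈ D.regions 0 R, w c =
      ∑ c, if c ∈ D.regions 0 R then w c else 0 := fun R => by
    rw [← Finset.sum_filter]
    simp
  simp_rw [h]
  rw [Finset.sum_comm]
  refine Finset.sum_congr rfl fun c _ => ?_
  rw [← Finset.sum_filter, Finset.sum_const, nsmul_eq_mul]
  congr!

theorem expectedZeroRegions_eq_sum_zeroProb [Fintype ι] [Fintype κ]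
    (D : ConfigurationSystem U ι κ b) (m : ℕ) :
    D.expectedZeroRegions m = ∑ c, D.zeroProb m c := by
  have h := D.sum_powersetCard_sum_regions m fun _ => 1
  simp only [Finset.sum_const, nsmul_eq_mul, mul_one] at h
  rw [expectedZeroRegions, h, Finset.card_powersetCard, Finset.card_univ, Finset.sum_div]
  rfl

/-- Some sample of size `m` has at most the expected total weight of `0`-regions. -/
theorem exists_sum_regions_le [Fintype ι] [Fintype κ] (D : ConfigurationSystem U ι κ b)
    {m : ℕ} (hm : m ≤ Fintype.card ι) (w : κ → ℝ) :
    ∃ R : Finset ι, R.card = m ∧ ∑ c ∈ D.regions 0 R, w c ≤ ∑ c, D.zeroProb m c * w c := by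
  have hpos : (0 : ℝ) < (Fintype.card ι).choose m := by exact_mod_cast Nat.choose_pos hm
  have hne : ((Finset.univ : Finset ι).powersetCard m).Nonempty :=
    Finset.powersetCard_nonempty.2 hm
  obtain ⟨R, hR, hle⟩ := Finset.exists_le_of_sum_le (f := fun R => ∑ c ∈ D.regions 0 R, w c)
    (g := fun _ => ∑ c, D.zeroProb m c * w c) hne (by
      rw [sum_powersetCard_sum_regions, Finset.sum_const, Finset.card_powersetCard,
        Finset.card_univ, nsmul_eq_mul, Finset.mul_sum]
      refine (Finset.sum_congr rfl fun c _ => ?_).le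
      rw [zeroProb]
      field_simp)
  exact ⟨R, (Finset.mem_powersetCard.1 hR).2, hle⟩

theorem sum_zeroProb_two_mul_sq_le [Fintype ι] [Fintype κ] (D : ConfigurationSystem U ι κ b)
    {r : ℕ} (hr : 1 ≤ r) (hb : 2 * b ≤ r) (hn : 2 * r ≤ Fintype.card ι) :
    ∑ c, D.zeroProb (2 * r) c * (((D.conflictSet c).card : ℝ) * r / Fintype.card ι) ^ 2 ≤
      2 * Real.exp (2 * b) * D.expectedZeroRegions r := by
  rw [expectedZeroRegions_eq_sum_zeroProb, Finset.mul_sum]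
  refine Finset.sum_le_sum fun c _ => ?_
  have hprob := D.zeroProb_two_mul_le hr hb hn c
  have ht : 0 ≤ ((D.conflictSet c).card : ℝ) * r / Fintype.card ι := by positivity
  set t : ℝ := ((D.conflictSet c).card : ℝ) * r / Fintype.card ι
  -- The factor `exp t` cancels the decay `exp (-t)`, leaving `exp (2b)`.
  have hexp : t ^ 2 ≤ 2 * Real.exp t := by
    have := Real.quadratic_le_exp_of_nonneg ht
    linarith
  have hp := D.zeroProb_nonneg r c
  calc D.zeroProb (2 * r) c * t ^ 2
      ≤ (D.zeroProb r c * Real.exp (2 * b - t)) * (2 * Real.exp t) := by gcongr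
    _ = 2 * (Real.exp (2 * b - t) * Real.exp t) * D.zeroProb r c := by ring
    _ = 2 * Real.exp (2 * b) * D.zeroProb r c := by rw [← Real.exp_add, sub_add_cancel]

end ConfigurationSystem

/-! ### Assembling the net -/

theorem mainTheorem1 (b : ℕ) (K : ℝ) :
    ∃ C : ℝ, 0 < C ∧
      ∀ (U : Type*) (ι : Type*) (κ : Type*) [Fintype ι] [Fintype κ]
        (D : ConfigurationSystem U ι κ b),
        D.IsComplete → D.LikelyNetsExist K →
        ∀ r : ℕ, 1 ≤ r → 2 * b ≤ r → r ≤ Fintype.card ι →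
          ∃ N : Finset ι, D.IsNet (1 / (r : ℝ)) Finset.univ N ∧
            (N.card : ℝ) ≤ C * max (r : ℝ) (D.expectedZeroRegions r) := by
  classical
  -- The `2` pays for the `2r` sampled objects; the rest is `4|K|` from the local nets times `2 exp
  -- (2b)` from the averaging.
  refine ⟨2 + 8 * |K| * Real.exp (2 * b), by positivity, ?_⟩
  intro U ι κ _ _ D hD hK r hr hb hrn
  have hr' : (0 : ℝ) < r := by exact_mod_cast hr
  set M := max (r : ℝ) (D.expectedZeroRegions r)
  have hrM : (r : ℝ) ≤ M := le_max_left _ _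
  have hM0 : 0 ≤ M := hr'.le.trans hrM
  have hCM : 2 * M ≤ (2 + 8 * |K| * Real.exp (2 * b)) * M :=
    mul_le_mul_of_nonneg_right (le_add_of_nonneg_right (by positivity)) hM0
  have hdeep_iff : ∀ p, 1 / (r : ℝ) * ((Finset.univ : Finset ι).card : ℝ) ≤
      (D.depth Finset.univ p : ℝ) → (Fintype.card ι : ℝ) / r ≤ D.depth Finset.univ p := by
    intro p hp
    rwa [Finset.card_univ, one_div_mul_eq_div] at hp
  -- With fewer than `2r` objects no such sample exists, but taking all objects is cheap enough.
  rcases lt_or_ge (Fintype.card ι) (2 * r) with hlt | hge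
  · refine ⟨Finset.univ, ⟨subset_rfl, fun p hp => ?_⟩, ?_⟩
    · have hpos : 0 < D.depth Finset.univ p := by
        have hn : (0 : ℝ) < Fintype.card ι := by exact_mod_cast hr.trans hrn
        exact_mod_cast (div_pos hn hr').trans_le (hdeep_iff p hp)
      obtain ⟨s, hs⟩ := Finset.card_pos.1 hpos
      exact Set.mem_biUnion (Finset.mem_univ s) (Finset.mem_filter.1 hs).2
    · have : (Fintype.card ι : ℝ) ≤ 2 * r := by exact_mod_cast hlt.le
      rw [Finset.card_univ]
      linarith
  · choose N hNcard hNcov using ConfigurationSystem.exists_local_net hD hK hr (hr.trans hrn)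
    obtain ⟨R, hRcard, hR⟩ := D.exists_sum_regions_le hge fun c =>
      4 * |K| * (((D.conflictSet c).card : ℝ) * r / Fintype.card ι) ^ 2
    refine ⟨R ∪ (D.regions 0 R).biUnion N, ⟨Finset.subset_univ _, fun p hp => ?_⟩, ?_⟩
    · by_cases hpR : p ∈ D.cover R
      · exact Set.biUnion_mono (fun s hs => Finset.mem_union_left _ hs) (fun _ _ => subset_rfl) hpR
      · obtain ⟨c, hc, hpc⟩ := hD R p hpR
        exact Set.biUnion_mono
          (fun s hs => Finset.mem_union_right _ (Finset.mem_biUnion.2 ⟨c, hc, hs⟩))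
          (fun _ _ => subset_rfl) (hNcov c p hpc (hdeep_iff p hp))
    · have hsum : (((D.regions 0 R).biUnion N).card : ℝ) ≤
          4 * |K| * (2 * Real.exp (2 * b) * M) := by
        calc (((D.regions 0 R).biUnion N).card : ℝ)
            ≤ ∑ c ∈ D.regions 0 R, ((N c).card : ℝ) := by
              exact_mod_cast Finset.card_biUnion_le
          _ ≤ _ := Finset.sum_le_sum fun c _ => hNcard c
          _ ≤ _ := hR
          _ = 4 * |K| * ∑ c, D.zeroProb (2 * r) c *
                (((D.conflictSet c).card : ℝ) * r / Fintype.card ι) ^ 2 := by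
              rw [Finset.mul_sum]
              exact Finset.sum_congr rfl fun c _ => by ring
          _ ≤ 4 * |K| * (2 * Real.exp (2 * b) * D.expectedZeroRegions r) := by
              gcongr
              exact D.sum_zeroProb_two_mul_sq_le hr hb hge
          _ ≤ 4 * |K| * (2 * Real.exp (2 * b) * M) := by
              gcongr
              exact le_max_right _ _
      have hunion : ((R ∪ (D.regions 0 R).biUnion N).card : ℝ) ≤
          2 * r + ((D.regions 0 R).biUnion N).card := by
        have := Finset.card_union_le R ((D.regions 0 R).biUnion N)
        rw [hRcard] at this
        exact_mod_cast this
      linarith
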